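/- For a field $K$ and a finite group $G$, let $G$ act on the rational function field $K(x(g) : g\in G)$ by $K$-automorphisms with $h\cdot x(g)=x(hg)$, and let $K(G)=K(x(g):g\in G)^G$ be the fixed field. A field extension $L/F$ is called rational if $L=F(t_1,\dots,t_m)$ for some $m\ge 0$ and some $t_1,\dots,t_m\in L$ algebraically independent over $F$. It is called retract rational if $L$ is the quotient field of some $F$-subalgebra $A\subseteq L$ for which there are $m\ge 0$, a nonzero polynomial $f\in F[X_1,\dots,X_m]$ and $F$-algebra homomorphisms $\varphi:A\to F[X_1,\dots,X_m][1/f]$ and $\psi:F[X_1,\dots,X_m][1/f]\to A$ with $\psi\circ\varphi=\mathrm{id}_A$. Let $D_n$ denote the dihedral group of order $2n$. **Theorem 1.5.** Let $K$ be any field and let $n\geq 1$ be an odd integer. Then there is a $K$-embedding of $K(D_n)$ into $K(D_{2n})$ such that $K(D_{2n})$ is rational over (the image of) $K(D_n)$. In particular, if $K(D_n)$ is rational (resp. retract rational) over $K$, then so is $K(D_{2n})$. -/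

import Mathlib

/-- The rational function field `K(x(g) : g ∈ G)` in variables indexed by `G`. -/
abbrev RegularFunctionField (K : Type*) [Field K] (G : Type*) : Type _ :=
  FractionRing (MvPolynomial G K)

/-- The action of `G` on `K(x(g) : g ∈ G)` by `K`-automorphisms with `h · x(g) = x(h g)`. -/
noncomputable def regularAction (K : Type*) [Field K] (G : Type*) [Group G] :
    G →* (RegularFunctionField K G ≃ₐ[K] RegularFunctionField K G) :=
  (IsFractionRing.fieldEquivOfAlgEquivHom (A := K) (B := MvPolynomial G K) K
      (RegularFunctionField K G)).comp
    { toFun := fun h => MvPolynomial.renameEquiv K (Equiv.mulLeft h)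
      map_one' := by
        ext f
        simp
      map_mul' := fun a b => by
        apply AlgEquiv.ext
        intro f
        simp only [AlgEquiv.mul_apply, MvPolynomial.renameEquiv_apply, MvPolynomial.rename_rename]
        congr 1
        ext g
        simp [mul_assoc] }

/-- The defining formula `h · x(g) = x(h g)`. -/
theorem regularAction_X (K : Type*) [Field K] (G : Type*) [Group G] (h g : G) :
    regularAction K G h
        (algebraMap (MvPolynomial G K) (RegularFunctionField K G) (MvPolynomial.X g)) =
      algebraMap (MvPolynomial G K) (RegularFunctionField K G) (MvPolynomial.X (h * g)) := by
  simp [regularAction]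

/-- Noether's field `K(G) = K(x(g) : g ∈ G)^G`, an intermediate field of
`K ⊆ K(x(g) : g ∈ G)`. -/
noncomputable def noetherField (K : Type*) [Field K] (G : Type*) [Group G] :
    IntermediateField K (RegularFunctionField K G) :=
  IntermediateField.fixedField (regularAction K G).range

/-- `L` is rational over `F`: `L = F(t₁, …, tₘ)` with `t₁, …, tₘ` algebraically independent
over `F`. -/
def IsRationalOver (F L : Type*) [Field F] [Field L] [Algebra F L] : Prop :=
  ∃ (m : ℕ) (t : Fin m → L),
    AlgebraicIndependent F t ∧ IntermediateField.adjoin F (Set.range t) = ⊤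

/-- `L` is retract rational over `F`: `L` is the fraction field of an `F`-subalgebra `A` whose
identity map factors, through `F`-algebra homomorphisms, as `A → F[X₁, …, Xₘ][1/f] → A` for some
`m` and some nonzero polynomial `f`. (Such an `A` is automatically finitely generated, and any
`F`-domain with fraction field `L` is isomorphic to a subalgebra of `L`.) -/
def IsRetractRationalOver (F L : Type*) [Field F] [Field L] [Algebra F L] : Prop :=
  ∃ (A : Subalgebra F L) (m : ℕ) (f : MvPolynomial (Fin m) F)
    (φ : A →ₐ[F] Localization.Away f) (ψ : Localization.Away f →ₐ[F] A),
    IsFractionRing A L ∧ f ≠ 0 ∧ ψ.comp φ = AlgHom.id F A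

-- For odd `n` the group H = D_{2n} is the product of G = D_n and a central involution c, and only
-- this splitting is used. Write s(g) = x(g) + x(gc). Sending x(g) to s(g) embeds E = K(x(g) : g ∈
-- G) into M = K(x(h) : h ∈ H), equivariantly for G and with c acting trivially on the image, so F =
-- K(G) embeds into Φ = K(H).
--
-- Put m_k = ∑ s(g)^k x(g), p_k = ∑ s(g)^(k+1) and w = m_0 / p_0. All three are G-invariant; c fixes
-- p_k, sends m_k to p_k - m_k and w to 1 - w. Hence w(1 - w) and θ_k = (m_k - w p_k)/(2w - 1) lie
-- in Φ, in every characteristic. Let N = |G| and let L be generated over F by w(1 - w) and θ_1,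
-- ..., θ_{N-1}. Over E, L and w together give back m_0, ..., m_{N-1}, and Lagrange interpolation at
-- the distinct nodes s(g) (`Subfield.mem_of_power_moments_mem`) gives back each x(g), so they
-- generate M. Therefore [M : L] ≤ 2[E : F] = 2N = [M : Φ], which forces L = Φ. Since Φ has
-- transcendence degree 2N - N = N over F, the N generators are algebraically independent
-- (`isRationalOver_of_degree_le`).
--
-- Rationality then passes up by transitivity, and retract rationality by adjoining polynomial
-- variables to the retract.

universe u v

/-! ### Degree bounds and a numerical criterion for rationality -/

/-- The degree of a compositum over one factor is at most the degree of the other factor over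
the base field. -/
theorem finrank_le_of_compositum {F E L M : Type*} [Field F] [Field E] [Field L] [Field M]
    [Algebra F E] [Algebra F L] [Algebra F M] [Algebra E M] [Algebra L M]
    [IsScalarTower F E M] [IsScalarTower F L M] [FiniteDimensional F E]
    (hgen : ∀ S : Subfield M, (∀ e, algebraMap E M e ∈ S) → (∀ l, algebraMap L M l ∈ S) → S = ⊤) :
    FiniteDimensional L M ∧ Module.finrank L M ≤ Module.finrank F E := by
  let φ : TensorProduct F L E →ₐ[L] M :=
    Algebra.TensorProduct.lift (Algebra.ofId L M) (IsScalarTower.toAlgHom F E M)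
      (fun _ _ => Commute.all _ _)
  have hφE : ∀ e, algebraMap E M e ∈ φ.range := fun e =>
    ⟨1 ⊗ₜ[F] e, by simp [φ]⟩
  have halg : Algebra.IsAlgebraic L φ.range := by
    have : Module.Finite L φ.range := Module.Finite.range φ.toLinearMap
    infer_instance
  -- The range is a domain integral over the field `L`, hence a field, and it contains generators of
  -- `M`.
  have hfield : IsField φ.range := isField_of_isIntegral_of_isField' (Field.toIsField L)
  have htop : (φ.range.toIntermediateField' hfield).toSubfield = ⊤ :=
    hgen _ hφE (fun l => φ.range.algebraMap_mem l)
  have hsurj : Function.Surjective φ := fun x => by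
    have hx : x ∈ (φ.range.toIntermediateField' hfield).toSubfield := by
      rw [htop]; trivial
    exact hx
  refine ⟨Module.Finite.of_surjective φ.toLinearMap hsurj, ?_⟩
  calc Module.finrank L M ≤ Module.finrank L (TensorProduct F L E) :=
        LinearMap.finrank_le_finrank_of_surjective (f := φ.toLinearMap) hsurj
    _ = Module.finrank F E := Module.finrank_baseChange

/-- Adjoining a root of `X ^ 2 - X + q` gives an extension of degree at most two. -/
theorem finrank_adjoin_quadratic_le {L M : Type*} [Field L] [Field M] [Algebra L M] {w : M} {q : L}
    (hw : w * (1 - w) = algebraMap L M q) :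
    FiniteDimensional L (IntermediateField.adjoin L {w}) ∧
      Module.finrank L (IntermediateField.adjoin L {w}) ≤ 2 := by
  have hmonic : (Polynomial.X ^ 2 - Polynomial.X + Polynomial.C q).Monic := by monicity!
  have hdeg : (Polynomial.X ^ 2 - Polynomial.X + Polynomial.C q).natDegree = 2 := by
    compute_degree!
  have hroot : Polynomial.aeval w (Polynomial.X ^ 2 - Polynomial.X + Polynomial.C q) = 0 := by
    simp [← hw]; ring
  have hint : IsIntegral L w := ⟨_, hmonic, by rwa [← Polynomial.aeval_def]⟩
  refine ⟨IntermediateField.adjoin.finiteDimensional hint, ?_⟩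
  rw [IntermediateField.adjoin.finrank hint, ← hdeg]
  exact Polynomial.natDegree_le_natDegree (minpoly.min L w hmonic hroot)

/-- A family generating `L` over `F`, with at most as many members as the transcendence degree,
is algebraically independent. -/
theorem algebraicIndependent_of_adjoin_eq_top {F L : Type*} [Field F] [Field L] [Algebra F L]
    {N : ℕ} (T : Fin N → L) (htop : IntermediateField.adjoin F (Set.range T) = ⊤)
    (htr : (N : Cardinal) ≤ Algebra.trdeg F L) : AlgebraicIndependent F T := by
  have : Algebra.IsAlgebraic (Algebra.adjoin F (Set.range T)) L := by
    have : Algebra.IsAlgebraic (IntermediateField.adjoin F (Set.range T)) L :=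
      ⟨fun x => isAlgebraic_algebraMap
        (⟨x, by rw [htop]; trivial⟩ : IntermediateField.adjoin F (Set.range T))⟩
    exact IntermediateField.isAlgebraic_adjoin_iff_top.mp this
  refine (Algebra.IsAlgebraic.isTranscendenceBasis_of_lift_le_trdeg_of_finite F T ?_).1
  simpa using htr

/-- Degree bound for the compositum with a finite extension and a quadratic element. -/
theorem finrank_le_of_compositum_quadratic {F E L M : Type*} [Field F] [Field E] [Field L]
    [Field M] [Algebra F E] [Algebra F L] [Algebra F M] [Algebra E M] [Algebra L M]
    [IsScalarTower F E M] [IsScalarTower F L M] [FiniteDimensional F E] {w : M} {q : L}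
    (hw : w * (1 - w) = algebraMap L M q)
    (hgen : ∀ S : Subfield M, (∀ e, algebraMap E M e ∈ S) → (∀ l, algebraMap L M l ∈ S) →
      w ∈ S → S = ⊤) :
    FiniteDimensional L M ∧ Module.finrank L M ≤ 2 * Module.finrank F E := by
  let P := IntermediateField.adjoin L {w}
  obtain ⟨hP, hP2⟩ := finrank_adjoin_quadratic_le hw
  let _ : Algebra F P := ((algebraMap L P).comp (algebraMap F L)).toAlgebra
  have : IsScalarTower F P M :=
    IsScalarTower.of_algebraMap_eq fun x => IsScalarTower.algebraMap_apply F L M x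
  obtain ⟨hPM, hPM2⟩ : FiniteDimensional P M ∧ Module.finrank P M ≤ Module.finrank F E := by
    refine finrank_le_of_compositum fun S hS1 hS2 => hgen S hS1 (fun l => ?_) ?_
    · exact hS2 (algebraMap L P l)
    · exact hS2 ⟨w, IntermediateField.mem_adjoin_simple_self L w⟩
  refine ⟨FiniteDimensional.trans L P M, ?_⟩
  rw [← Module.finrank_mul_finrank L P M]
  exact Nat.mul_le_mul hP2 hPM2

/-- A numerical criterion for rationality of an intermediate extension. -/
theorem isRationalOver_of_degree_le {F E Φ M : Type u} [Field F] [Field E] [Field Φ] [Field M]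
    [Algebra F E] [Algebra F Φ] [Algebra F M] [Algebra E M] [Algebra Φ M]
    [IsScalarTower F E M] [IsScalarTower F Φ M] [FiniteDimensional F E] [FiniteDimensional Φ M]
    {N : ℕ} (hE : Module.finrank F E ≤ N) (hM : Module.finrank Φ M = 2 * N)
    (htr : Algebra.trdeg F M = N) (T : Fin N → Φ) (w : M)
    (hw : ∃ k, w * (1 - w) = algebraMap Φ M (T k))
    (hgen : ∀ S : Subfield M, (∀ e, algebraMap E M e ∈ S) → (∀ j, algebraMap Φ M (T j) ∈ S) →
      w ∈ S → S = ⊤) :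
    IsRationalOver F Φ := by
  have hΦ : Algebra.trdeg F Φ = N := by
    rw [← htr, ← trdeg_add_eq F Φ (A := M), trdeg_eq_zero (R := Φ), add_zero]
  let L := IntermediateField.adjoin F (Set.range T)
  have hT : ∀ j, T j ∈ L := fun j => IntermediateField.subset_adjoin _ _ ⟨j, rfl⟩
  obtain ⟨k, hk⟩ := hw
  have hk' : w * (1 - w) = algebraMap L M ⟨T k, hT k⟩ := hk
  have : IsScalarTower F L M :=
    IsScalarTower.of_algebraMap_eq fun x => IsScalarTower.algebraMap_apply F Φ M x
  obtain ⟨hfin, hLM⟩ := finrank_le_of_compositum_quadratic (F := F) (E := E) hk'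
    fun S hS1 hS2 => hgen S hS1 (fun j => hS2 ⟨T j, hT j⟩)
  replace hLM := hLM.trans (Nat.mul_le_mul_left 2 hE)
  have hfinΦ : FiniteDimensional L Φ := FiniteDimensional.left L Φ M
  -- [Φ : L] · 2N = [M : L] ≤ 2N with 2N positive.
  have hone : Module.finrank L Φ = 1 := by
    rw [← Module.finrank_mul_finrank L Φ M, hM] at hLM
    have h1 : 0 < Module.finrank L Φ := Module.finrank_pos
    have h2 : 0 < 2 * N := hM ▸ Module.finrank_pos
    nlinarith
  have htop : L = ⊤ := IntermediateField.finrank_eq_one_iff_eq_top.1 hone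
  exact ⟨N, T, algebraicIndependent_of_adjoin_eq_top T htop hΦ.ge, htop⟩

/-! ### Transitivity of rationality and retract rationality -/

/-- Subfields do not remember a base field, so generation over different bases of a tower becomes
comparable. -/
theorem IntermediateField.adjoin_eq_top_iff_subfield {E L : Type*} [Field E] [Field L] [Algebra E L]
    {S : Set L} : IntermediateField.adjoin E S = ⊤ ↔
      ∀ P : Subfield L, (∀ e, algebraMap E L e ∈ P) → S ⊆ P → P = ⊤ := by
  refine ⟨fun h P hE hS => ?_, fun h => ?_⟩
  · have hle : IntermediateField.adjoin E S ≤ P.toIntermediateField hE :=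
      IntermediateField.adjoin_le_iff.2 hS
    rw [h] at hle
    exact top_le_iff.1 fun x _ => hle (IntermediateField.mem_top (x := x))
  · have := h (IntermediateField.adjoin E S).toSubfield
      (fun e => (IntermediateField.adjoin E S).algebraMap_mem e)
      (IntermediateField.subset_adjoin E S)
    refine top_le_iff.1 fun x _ => ?_
    have hx : x ∈ (IntermediateField.adjoin E S).toSubfield := by rw [this]; trivial
    exact hx

theorem IsRationalOver.trans {K E L : Type*} [Field K] [Field E] [Field L] [Algebra K E]
    [Algebra E L] [Algebra K L] [IsScalarTower K E L] (h₁ : IsRationalOver K E)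
    (h₂ : IsRationalOver E L) : IsRationalOver K L := by
  obtain ⟨m, s, hs, hs'⟩ := h₁
  obtain ⟨n, t, ht, ht'⟩ := h₂
  refine ⟨n + m, Sum.elim t (algebraMap E L ∘ s) ∘ finSumFinEquiv.symm,
    (hs.sumElim_comp ht).comp _ finSumFinEquiv.symm.injective, ?_⟩
  rw [EquivLike.range_comp, Set.Sum.elim_range]
  rw [IntermediateField.adjoin_eq_top_iff_subfield] at hs' ht' ⊢
  intro P hK hP
  refine ht' P (fun e => ?_) fun x hx => hP (Or.inl hx)
  have hcomap : P.comap (algebraMap E L) = ⊤ := hs' _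
    (fun k => by simpa [← IsScalarTower.algebraMap_apply] using hK k)
    (by rintro _ ⟨i, rfl⟩; exact hP (Or.inr ⟨i, rfl⟩))
  have he : e ∈ P.comap (algebraMap E L) := by rw [hcomap]; trivial
  exact he

/-- The subalgebra in the definition of retract rationality may be replaced by an abstract
algebra. -/
theorem IsRetractRationalOver.of_algebra {K L A : Type*} [Field K] [Field L] [Algebra K L]
    [CommRing A] [Algebra K A] [Algebra A L] [IsScalarTower K A L] [IsFractionRing A L] {m : ℕ}
    {f : MvPolynomial (Fin m) K} (hf : f ≠ 0) (φ : A →ₐ[K] Localization.Away f)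
    (ψ : Localization.Away f →ₐ[K] A) (h : ψ.comp φ = AlgHom.id K A) :
    IsRetractRationalOver K L := by
  let g : A →ₐ[K] L := IsScalarTower.toAlgHom K A L
  let e : A ≃ₐ[K] g.range := AlgEquiv.ofInjective g (IsFractionRing.injective A L)
  refine ⟨g.range, m, f, φ.comp e.symm.toAlgHom, e.toAlgHom.comp ψ, ?_, hf, ?_⟩
  · refine IsFractionRing.of_field _ _ fun z => ?_
    obtain ⟨x, y, -, rfl⟩ := IsFractionRing.div_surjective A z
    exact ⟨e x, e y, rfl⟩
  · ext x
    have := DFunLike.congr_fun h (e.symm x)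
    simp only [AlgHom.comp_apply, AlgHom.id_apply] at this
    simp [this]

/-- Elements of `E` are quotients of elements of `A`, so the quotients of values at `t` of
polynomials over `A` already form a subfield containing `E` and `t`. -/
theorem isFractionRing_mvPolynomial_of_adjoin_eq_top {E L A ι : Type*} [Field E] [Field L]
    [CommRing A] [Algebra E L] [Algebra A E] [Algebra A L] [IsScalarTower A E L]
    [IsFractionRing A E] {t : ι → L} (ht : AlgebraicIndependent E t)
    (ht' : IntermediateField.adjoin E (Set.range t) = ⊤) [Algebra (MvPolynomial ι A) L]
    (halg : algebraMap (MvPolynomial ι A) L = (MvPolynomial.aeval t : _ →ₐ[A] L).toRingHom) :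
    IsFractionRing (MvPolynomial ι A) L := by
  have hA : AlgebraicIndependent A t := ht.restrictScalars (IsFractionRing.injective A E)
  have hinj : Function.Injective (algebraMap (MvPolynomial ι A) L) := by
    rw [halg]; exact hA
  have : FaithfulSMul (MvPolynomial ι A) L := (faithfulSMul_iff_algebraMap_injective _ _).2 hinj
  have : IsDomain A := (IsFractionRing.injective A E).isDomain
  let S := (IsFractionRing.lift (K := FractionRing (MvPolynomial ι A)) hinj).fieldRange
  have hmem : ∀ p, algebraMap (MvPolynomial ι A) L p ∈ S := fun p =>
    ⟨algebraMap _ _ p, IsFractionRing.lift_algebraMap hinj p⟩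
  have hE : ∀ e, algebraMap E L e ∈ S := fun e => by
    obtain ⟨x, y, -, rfl⟩ := IsFractionRing.div_surjective A e
    rw [map_div₀, ← IsScalarTower.algebraMap_apply, ← IsScalarTower.algebraMap_apply]
    have h : ∀ a, algebraMap A L a ∈ S := fun a => by simpa [halg] using hmem (MvPolynomial.C a)
    exact div_mem (h x) (h y)
  have hS : S = ⊤ := IntermediateField.adjoin_eq_top_iff_subfield.1 ht' S hE <| by
    rintro _ ⟨i, rfl⟩
    simpa [halg] using hmem (MvPolynomial.X i)
  refine IsFractionRing.of_field _ _ fun z => ?_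
  obtain ⟨q, rfl⟩ := (hS ▸ trivial : z ∈ S)
  obtain ⟨x, y, -, rfl⟩ := IsFractionRing.div_surjective (MvPolynomial ι A) q
  refine ⟨x, y, ?_⟩
  simp

/-- Retract rationality passes to rational extensions. -/
theorem IsRetractRationalOver.trans_isRationalOver {K E L : Type*} [Field K] [Field E] [Field L]
    [Algebra K E] [Algebra E L] [Algebra K L] [IsScalarTower K E L]
    (h₁ : IsRetractRationalOver K E) (h₂ : IsRationalOver E L) : IsRetractRationalOver K L := by
  obtain ⟨A, m, f, φ, ψ, hfrac, hf, hφψ⟩ := h₁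
  obtain ⟨n, t, ht, ht'⟩ := h₂
  let _ : Algebra (MvPolynomial (Fin n) A) L :=
    (MvPolynomial.aeval t : _ →ₐ[A] L).toRingHom.toAlgebra
  have : IsScalarTower K (MvPolynomial (Fin n) A) L := IsScalarTower.of_algebraMap_eq fun x => by
    change _ = (MvPolynomial.aeval t : _ →ₐ[A] L) (MvPolynomial.C (algebraMap K A x))
    rw [MvPolynomial.aeval_C, ← IsScalarTower.algebraMap_apply]
  have : IsFractionRing (MvPolynomial (Fin n) A) L :=
    isFractionRing_mvPolynomial_of_adjoin_eq_top ht ht' rfl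
  -- The polynomial ring over `A` is a retract of K[X_1, ..., X_{m+n}][1/f] with `f` in the first
  -- `m` variables: `φ` and `ψ` act on these, and the last `n` variables correspond to those over
  -- `A`.
  let incl : MvPolynomial (Fin m) K →ₐ[K] MvPolynomial (Fin (m + n)) K :=
    MvPolynomial.rename (Fin.castAdd n)
  have hincl : incl f ≠ 0 := by
    rw [Ne, map_eq_zero_iff _ (MvPolynomial.rename_injective _ (Fin.castAdd_injective m n))]
    exact hf
  let ρ : MvPolynomial (Fin (m + n)) K →ₐ[K] Localization.Away (incl f) :=
    IsScalarTower.toAlgHom K _ _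
  have hρ : ∀ y : Submonoid.powers f, IsUnit (ρ.comp incl y) := by
    rintro ⟨_, k, rfl⟩
    rw [map_pow]
    exact (IsLocalization.Away.algebraMap_isUnit (incl f)).pow k
  let β : Localization.Away f →ₐ[K] Localization.Away (incl f) := IsLocalization.liftAlgHom hρ
  let φ' : MvPolynomial (Fin n) A →ₐ[K] Localization.Away (incl f) :=
    MvPolynomial.aevalTower (β.comp φ) fun j => ρ (MvPolynomial.X (Fin.natAdd m j))
  let cA : A →ₐ[K] MvPolynomial (Fin n) A := IsScalarTower.toAlgHom K _ _
  let σ : MvPolynomial (Fin m) K →ₐ[K] Localization.Away f := IsScalarTower.toAlgHom K _ _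
  let τ : MvPolynomial (Fin (m + n)) K →ₐ[K] MvPolynomial (Fin n) A :=
    MvPolynomial.aeval (Fin.append (fun i => cA (ψ (σ (MvPolynomial.X i)))) MvPolynomial.X)
  have hτ : τ.comp incl = cA.comp (ψ.comp σ) := by
    ext i : 1
    simp [τ, incl]
  -- `τ` sends `incl f` to the constant ψ(f), a unit because `f` is inverted in the source of `ψ`.
  have hτu : ∀ y : Submonoid.powers (incl f), IsUnit (τ y) := by
    rintro ⟨_, k, rfl⟩
    rw [map_pow, ← AlgHom.comp_apply, hτ]
    exact (((IsLocalization.Away.algebraMap_isUnit f).map ψ).map cA).pow k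
  let ψ' : Localization.Away (incl f) →ₐ[K] MvPolynomial (Fin n) A :=
    IsLocalization.liftAlgHom hτu
  have hψρ : ∀ p, ψ' (ρ p) = τ p := fun p => IsLocalization.lift_eq _ p
  have hβσ : ∀ p, β (σ p) = ρ (incl p) := fun p => IsLocalization.lift_eq _ p
  have hψβ : ψ'.comp β = cA.comp ψ := by
    refine IsLocalization.algHom_ext (Submonoid.powers f) ?_
    ext i : 1
    change ψ' (β (σ _)) = cA (ψ (σ _))
    rw [hβσ, hψρ, ← AlgHom.comp_apply, hτ]
    rfl
  refine IsRetractRationalOver.of_algebra hincl φ' ψ' ?_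
  refine MvPolynomial.algHom_ext' ?_ fun j => ?_
  · ext a : 1
    have h1 : φ' (MvPolynomial.C a) = β (φ a) := MvPolynomial.aevalTower_C _ _ _
    have h2 := DFunLike.congr_fun hψβ (φ a)
    have h3 := DFunLike.congr_fun hφψ a
    simp only [AlgHom.comp_apply, AlgHom.id_apply] at h2 h3
    change ψ' (φ' (MvPolynomial.C a)) = MvPolynomial.C a
    rw [h1, h2, h3]
    rfl
  · have h1 : φ' (MvPolynomial.X j) = ρ (MvPolynomial.X (Fin.natAdd m j)) :=
      MvPolynomial.aevalTower_X _ _ _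
    change ψ' (φ' (MvPolynomial.X j)) = MvPolynomial.X j
    rw [h1, hψρ]
    simp [τ]

/-- Rationality over an extension field and over its image agree. -/
theorem isRationalOver_fieldRange {K E L : Type*} [Field K] [Field E] [Field L] [Algebra K E]
    [Algebra K L] (i : E →ₐ[K] L) :
    letI := i.toRingHom.toAlgebra
    IsRationalOver i.fieldRange L ↔ IsRationalOver E L := by
  let := i.toRingHom.toAlgebra
  have hai : ∀ {m : ℕ} (t : Fin m → L),
      AlgebraicIndependent E t ↔ AlgebraicIndependent i.fieldRange t := fun t =>
    (algebraicIndependent_ringHom_iff_of_comp_eq (AlgEquiv.ofInjectiveField i)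
      (RingHom.id L) Function.injective_id rfl).symm
  have had : ∀ S : Set L, IntermediateField.adjoin i.fieldRange S = ⊤ ↔
      IntermediateField.adjoin E S = ⊤ := fun S => by
    have h : ∀ P : Subfield L, (∀ e, algebraMap i.fieldRange L e ∈ P) ↔
        ∀ e, algebraMap E L e ∈ P := fun P =>
      ⟨fun h e => h ⟨_, e, rfl⟩, by rintro h ⟨_, e, rfl⟩; exact h e⟩
    simp only [IntermediateField.adjoin_eq_top_iff_subfield, h]
  simp only [IsRationalOver, hai, had]

theorem IsRationalOver.of_fieldRange {K E L : Type*} [Field K] [Field E] [Field L] [Algebra K E]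
    [Algebra K L] (i : E →ₐ[K] L) (hi : IsRationalOver i.fieldRange L) (h : IsRationalOver K E) :
    IsRationalOver K L := by
  rw [isRationalOver_fieldRange] at hi
  let := i.toRingHom.toAlgebra
  have : IsScalarTower K E L := IsScalarTower.of_algebraMap_eq fun k => (i.commutes k).symm
  exact h.trans hi

theorem IsRetractRationalOver.of_fieldRange {K E L : Type*} [Field K] [Field E] [Field L]
    [Algebra K E] [Algebra K L] (i : E →ₐ[K] L) (hi : IsRationalOver i.fieldRange L)
    (h : IsRetractRationalOver K E) : IsRetractRationalOver K L := by
  rw [isRationalOver_fieldRange] at hi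
  let := i.toRingHom.toAlgebra
  have : IsScalarTower K E L := IsScalarTower.of_algebraMap_eq fun k => (i.commutes k).symm
  exact h.trans_isRationalOver hi

/-! ### Interpolation from moments, and Artin's theorem -/

/-- If the power moments `∑ (s h) ^ k * y h` of a vector `y` with distinct nodes `s h` lie in a
subfield containing the nodes, so do the entries of `y`. -/
theorem Subfield.mem_of_power_moments_mem {M ι : Type*} [Field M] [Fintype ι] (S : Subfield M)
    (s y : ι → M) (hinj : Function.Injective s) (hs : ∀ i, s i ∈ S)
    (hy : ∀ k < Fintype.card ι, ∑ i, s i ^ k * y i ∈ S) (i : ι) : y i ∈ S := by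
  classical
  let s' : ι → S := fun i => ⟨s i, hs i⟩
  have hinj' : Function.Injective s' := fun a b h => hinj (congrArg Subtype.val h)
  -- This polynomial is 1 at node `i` and 0 at the others, and its coefficients lie in `S`; so `y i`
  -- is the combination of moments with these coefficients.
  let p := Lagrange.basis Finset.univ s' i
  have hdeg : p.natDegree < Fintype.card ι := by
    have h := Lagrange.degree_basis (s := Finset.univ) (v := s') hinj'.injOn (Finset.mem_univ i)
    have hpos : 0 < Fintype.card ι := Fintype.card_pos_iff.2 ⟨i⟩
    rw [Polynomial.natDegree_eq_of_degree_eq_some h, Finset.card_univ]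
    omega
  have heval : ∀ m, ((p.eval (s' m) : S) : M) = if m = i then 1 else 0 := fun m => by
    split_ifs with h
    · rw [h, Lagrange.eval_basis_self hinj'.injOn (Finset.mem_univ i)]; rfl
    · rw [Lagrange.eval_basis_of_ne (Ne.symm h) (Finset.mem_univ m)]; rfl
  have hsum : y i = ∑ k ∈ Finset.range (Fintype.card ι), (p.coeff k : M) * ∑ m, s m ^ k * y m := by
    calc y i = ∑ m, ((p.eval (s' m) : S) : M) * y m := by simp [heval]
      _ = ∑ m, ∑ k ∈ Finset.range (Fintype.card ι), (p.coeff k : M) * (s m ^ k * y m) := by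
          refine Finset.sum_congr rfl fun m _ => ?_
          rw [Polynomial.eval_eq_sum_range' hdeg]
          simp [s', Finset.sum_mul, mul_assoc]
      _ = _ := by rw [Finset.sum_comm]; simp [Finset.mul_sum]
  rw [hsum]
  exact sum_mem fun k hk => mul_mem (p.coeff k).2 (hy k (Finset.mem_range.1 hk))

/-- Together with `IntermediateField.finrank_fixedField`, this is Artin's theorem carried over from
`FixedPoints.subfield`. -/
theorem IntermediateField.finiteDimensional_fixedField {K M : Type*} [Field K] [Field M]
    [Algebra K M] (Γ : Subgroup (M ≃ₐ[K] M)) [Finite Γ] :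
    FiniteDimensional (IntermediateField.fixedField Γ) M :=
  inferInstanceAs (FiniteDimensional (FixedPoints.subfield Γ M) M)

theorem IntermediateField.finrank_fixedField {K M : Type*} [Field K] [Field M]
    [Algebra K M] (Γ : Subgroup (M ≃ₐ[K] M)) [Finite Γ] :
    Module.finrank (IntermediateField.fixedField Γ) M = Nat.card Γ := by
  have := Fintype.ofFinite Γ
  rw [Nat.card_eq_fintype_card]
  exact FixedPoints.finrank_eq_card Γ M

theorem IntermediateField.trdeg_eq_of_finiteDimensional {K M : Type*} [Field K] [Field M]
    [Algebra K M] (F : IntermediateField K M) [FiniteDimensional F M] :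
    Algebra.trdeg K F = Algebra.trdeg K M := by
  rw [← trdeg_add_eq K F (A := M), trdeg_eq_zero (R := F), add_zero]

/-! ### The regular function field and its fixed field -/

namespace RegularFunctionField

variable (K : Type u) [Field K] {G H : Type v}

/-- The variable `x(g)`. -/
noncomputable def var (g : G) : RegularFunctionField K G :=
  algebraMap (MvPolynomial G K) (RegularFunctionField K G) (MvPolynomial.X g)

theorem var_injective : Function.Injective (var K : G → RegularFunctionField K G) :=
  (IsFractionRing.injective _ _).comp (MvPolynomial.X_injective (R := K))

theorem regularAction_var [Group G] (h g : G) :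
    regularAction K G h (var K g) = var K (h * g) := regularAction_X K G h g

variable {K} in
theorem algHom_ext {B : Type*} [CommRing B] [Algebra K B] {f₁ f₂ : RegularFunctionField K G →ₐ[K] B}
    (h : ∀ g, f₁ (var K g) = f₂ (var K g)) : f₁ = f₂ := by
  refine IsLocalization.algHom_ext (nonZeroDivisors (MvPolynomial G K)) ?_
  ext g
  exact h g

variable {K} in
theorem subfield_eq_top {S : Subfield (RegularFunctionField K G)}
    (hK : ∀ k, algebraMap K (RegularFunctionField K G) k ∈ S) (hS : ∀ g, var K g ∈ S) :
    S = ⊤ := by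
  have hpoly : ∀ p : MvPolynomial G K, algebraMap _ (RegularFunctionField K G) p ∈ S := fun p => by
    induction p using MvPolynomial.induction_on with
    | C a => exact hK a
    | add p q hp hq => rw [map_add]; exact add_mem hp hq
    | mul_X p g hp => rw [map_mul]; exact mul_mem hp (hS g)
  refine top_le_iff.1 fun x _ => ?_
  obtain ⟨a, b, -, rfl⟩ := IsFractionRing.div_surjective (MvPolynomial G K) x
  exact div_mem (hpoly a) (hpoly b)

theorem trdeg_eq [Finite G] : Algebra.trdeg K (RegularFunctionField K G) = Nat.card G := by
  have : Algebra.IsAlgebraic (MvPolynomial G K) (RegularFunctionField K G) :=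
    IsLocalization.isAlgebraic _ (nonZeroDivisors (MvPolynomial G K))
  rw [← trdeg_add_eq K (MvPolynomial G K) (A := RegularFunctionField K G),
    trdeg_eq_zero (R := MvPolynomial G K), add_zero, MvPolynomial.trdeg_of_isDomain]
  simp [Nat.cast_card]

theorem regularAction_injective [Group G] : Function.Injective (regularAction K G) := fun a b h => by
  have := DFunLike.congr_fun h (var K 1)
  rw [regularAction_var, regularAction_var, mul_one, mul_one] at this
  exact var_injective K this

theorem mem_noetherField [Group G] {x : RegularFunctionField K G} :
    x ∈ noetherField K G ↔ ∀ g, regularAction K G g x = x := by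
  simp [noetherField]

theorem finite_range_regularAction [Group G] [Finite G] : Finite (regularAction K G).range :=
  Finite.of_surjective _ (regularAction K G).rangeRestrict_surjective

theorem finiteDimensional_noetherField [Group G] [Finite G] :
    FiniteDimensional (noetherField K G) (RegularFunctionField K G) :=
  have := finite_range_regularAction K (G := G)
  IntermediateField.finiteDimensional_fixedField _

theorem finrank_noetherField [Group G] [Finite G] :
    Module.finrank (noetherField K G) (RegularFunctionField K G) = Nat.card G := by
  have := finite_range_regularAction K (G := G)
  rw [Nat.card_congr (MonoidHom.ofInjective (regularAction_injective K)).toEquiv]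
  exact IntermediateField.finrank_fixedField _

theorem trdeg_noetherField [Group G] [Finite G] :
    Algebra.trdeg K (noetherField K G) = Nat.card G := by
  have := finiteDimensional_noetherField K (G := G)
  rw [← trdeg_eq K]
  exact IntermediateField.trdeg_eq_of_finiteDimensional _

end RegularFunctionField

theorem trdeg_add_eq_of_field (K : Type*) (F M : Type u) [Field K] [Field F] [Field M] [Algebra K F]
    [Algebra F M] [Algebra K M] [IsScalarTower K F M] :
    Algebra.trdeg K F + Algebra.trdeg F M = Algebra.trdeg K M :=
  trdeg_add_eq K F

/-! ### Products with a central involution -/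

/-- `H` is the internal direct product of the image of `G` under `j` and the group of order two
generated by `c`. -/
structure IsProdInvolution {G H : Type*} [Group G] [Group H] (j : G →* H) (c : H) : Prop where
  injective : Function.Injective j
  comm : ∀ h, c * h = h * c
  mul_self : c * c = 1
  apply_ne : ∀ g, j g ≠ c
  card_eq : Nat.card H = 2 * Nat.card G

namespace IsProdInvolution

section Group

variable {G H : Type*} [Group G] [Group H] {j : G →* H} {c : H} (hd : IsProdInvolution j c)
include hd

theorem apply_ne_apply_mul (a b : G) : j a ≠ j b * c := fun h =>
  hd.apply_ne (b⁻¹ * a) (by rw [map_mul, map_inv, h, inv_mul_cancel_left])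

/-- By counting: the disjoint cosets j(G) and j(G)c have 2|G| = |H| elements together. -/
theorem exists_eq [Finite G] [Finite H] (h : H) : ∃ g, h = j g ∨ h = j g * c := by
  let f : G ⊕ G → H := Sum.elim j fun g => j g * c
  have hf : Function.Injective f :=
    hd.injective.sumElim (fun a b h => hd.injective (mul_right_cancel h)) hd.apply_ne_apply_mul
  have hb : Function.Bijective f :=
    (Nat.bijective_iff_injective_and_card f).2 ⟨hf, by rw [Nat.card_sum, hd.card_eq, two_mul]⟩
  obtain ⟨g | g, hg⟩ := hb.2 h
  · exact ⟨g, Or.inl hg.symm⟩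
  · exact ⟨g, Or.inr hg.symm⟩

end Group

open RegularFunctionField

variable {K : Type u} [Field K] {G H : Type v} [Group G] [Group H] {j : G →* H} {c : H}

variable (K j c) in
/-- The sum `x(j g) + x(j g c)`. -/
noncomputable def pairSum (g : G) : RegularFunctionField K H := var K (j g) + var K (j g * c)

theorem aeval_pairSum_injective (hd : IsProdInvolution j c) :
    Function.Injective (MvPolynomial.aeval (pairSum K j c) :
      MvPolynomial G K →ₐ[K] RegularFunctionField K H) := by
  classical
  let p : MvPolynomial G K →ₐ[K] MvPolynomial H K :=
    MvPolynomial.aeval fun g => MvPolynomial.X (j g) + MvPolynomial.X (j g * c)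
  -- Setting every variable outside the image of `j` to 0 turns the sum for g back into x(g).
  let q : MvPolynomial H K →ₐ[K] MvPolynomial G K :=
    MvPolynomial.aeval (Function.extend j MvPolynomial.X 0)
  have hqp : q.comp p = AlgHom.id K _ := by
    ext g : 1
    have h : ¬∃ a, j a = j g * c := fun ⟨a, ha⟩ => hd.apply_ne_apply_mul a g ha
    simp [p, q, hd.injective.extend_apply, Function.extend_apply' _ _ _ h]
  have hp : Function.Injective p :=
    Function.LeftInverse.injective (g := q) fun x => DFunLike.congr_fun hqp x
  have h : (MvPolynomial.aeval (pairSum K j c) : MvPolynomial G K →ₐ[K] RegularFunctionField K H) =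
      (IsScalarTower.toAlgHom K (MvPolynomial H K) (RegularFunctionField K H)).comp p := by
    ext g : 1
    simp [p, pairSum, var]
  rw [h]
  exact (IsFractionRing.injective (MvPolynomial H K) (RegularFunctionField K H)).comp hp

/-- The embedding sending `x(g)` to `x(j g) + x(j g c)`. -/
noncomputable def embedding (K : Type u) [Field K] (hd : IsProdInvolution j c) :
    RegularFunctionField K G →ₐ[K] RegularFunctionField K H :=
  IsFractionRing.liftAlgHom hd.aeval_pairSum_injective

variable (hd : IsProdInvolution j c)

theorem embedding_var (g : G) : embedding K hd (var K g) = pairSum K j c g := by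
  simp [embedding, var]

include hd in
theorem pairSum_injective : Function.Injective (pairSum K j c) := fun a b h => by
  rw [← embedding_var hd, ← embedding_var hd] at h
  exact var_injective K ((embedding K hd).injective h)

theorem regularAction_pairSum (a g : G) :
    regularAction K H (j a) (pairSum K j c g) = pairSum K j c (a * g) := by
  simp [pairSum, regularAction_var, mul_assoc]

include hd in
theorem regularAction_involution_var (g : G) :
    regularAction K H c (var K (j g)) = pairSum K j c g - var K (j g) := by
  rw [regularAction_var, hd.comm, pairSum, add_sub_cancel_left]

include hd in
theorem regularAction_involution_pairSum (g : G) :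
    regularAction K H c (pairSum K j c g) = pairSum K j c g := by
  rw [pairSum, map_add, regularAction_var, regularAction_var, hd.comm, hd.comm, mul_assoc,
    hd.mul_self, mul_one, add_comm]

theorem regularAction_embedding (a : G) (x : RegularFunctionField K G) :
    regularAction K H (j a) (embedding K hd x) = embedding K hd (regularAction K G a x) := by
  have : ((regularAction K H (j a)).toAlgHom.comp (embedding K hd)) =
      (embedding K hd).comp (regularAction K G a).toAlgHom := algHom_ext fun g => by
    simp [embedding_var, regularAction_var, regularAction_pairSum]
  exact DFunLike.congr_fun this x

theorem regularAction_involution_embedding (x : RegularFunctionField K G) :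
    regularAction K H c (embedding K hd x) = embedding K hd x := by
  have : ((regularAction K H c).toAlgHom.comp (embedding K hd)) = embedding K hd :=
    algHom_ext fun g => by simp [embedding_var, regularAction_involution_pairSum hd]
  exact DFunLike.congr_fun this x

include hd in
theorem mem_noetherField_iff [Finite G] [Finite H] {x : RegularFunctionField K H} :
    x ∈ noetherField K H ↔
      (∀ a, regularAction K H (j a) x = x) ∧ regularAction K H c x = x := by
  rw [mem_noetherField]
  refine ⟨fun h => ⟨fun a => h _, h c⟩, fun ⟨h₁, h₂⟩ h => ?_⟩
  obtain ⟨a, rfl | rfl⟩ := hd.exists_eq h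
  · exact h₁ a
  · rw [map_mul, AlgEquiv.mul_apply, h₂, h₁]

/-- The embedding of `K(G)` into `K(H)`. -/
noncomputable def noetherEmbedding [Finite G] [Finite H] (K : Type u) [Field K]
    (hd : IsProdInvolution j c) : noetherField K G →ₐ[K] noetherField K H :=
  ((embedding K hd).comp (noetherField K G).val).codRestrict (noetherField K H).toSubalgebra
    fun x => (mem_noetherField_iff hd).2
      ⟨fun a => by
        change regularAction K H (j a) (embedding K hd x) = embedding K hd x
        rw [regularAction_embedding, (mem_noetherField K).1 x.2],
      regularAction_involution_embedding hd _⟩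

/-! ### Moments and the generators of the fixed field -/

section Moments

variable [Fintype G]

variable (K j c) in
/-- The moment `∑ s(g) ^ k x(j g)` where `s(g) = x(j g) + x(j g c)`. -/
noncomputable def moment (k : ℕ) : RegularFunctionField K H :=
  ∑ g, pairSum K j c g ^ k * var K (j g)

variable (K j c) in
/-- The power sum `∑ s(g) ^ (k + 1)` where `s(g) = x(j g) + x(j g c)`. -/
noncomputable def powerSum (k : ℕ) : RegularFunctionField K H :=
  ∑ g, pairSum K j c g ^ (k + 1)

variable (K j c) in
/-- An element moved to `1 - w` by the involution. -/
noncomputable def coord : RegularFunctionField K H := moment K j c 0 / powerSum K j c 0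

variable (K j c) in
/-- The invariant part of the `k`-th moment. -/
noncomputable def invariantMoment (k : ℕ) : RegularFunctionField K H :=
  (moment K j c k - coord K j c * powerSum K j c k) / (2 * coord K j c - 1)

theorem regularAction_moment (a : G) (k : ℕ) :
    regularAction K H (j a) (moment K j c k) = moment K j c k := by
  simp only [moment, map_sum, map_mul, map_pow, regularAction_pairSum, regularAction_var]
  simp only [← map_mul j]
  exact Equiv.sum_comp (Equiv.mulLeft a) fun g => pairSum K j c g ^ k * var K (j g)

theorem regularAction_powerSum (a : G) (k : ℕ) :
    regularAction K H (j a) (powerSum K j c k) = powerSum K j c k := by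
  simp only [powerSum, map_sum, map_pow, regularAction_pairSum]
  exact Equiv.sum_comp (Equiv.mulLeft a) fun g => pairSum K j c g ^ (k + 1)

include hd in
-- The involution fixes s(g) and sends x(j g) to s(g) - x(j g); the extra factor s(g) explains the
-- exponent k + 1 in `powerSum`.
theorem regularAction_involution_moment (k : ℕ) :
    regularAction K H c (moment K j c k) = powerSum K j c k - moment K j c k := by
  simp only [moment, powerSum, map_sum, map_mul, map_pow, regularAction_involution_pairSum hd,
    regularAction_involution_var hd, ← Finset.sum_sub_distrib]
  exact Finset.sum_congr rfl fun g _ => by ring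

include hd in
theorem regularAction_involution_powerSum (k : ℕ) :
    regularAction K H c (powerSum K j c k) = powerSum K j c k := by
  simp only [powerSum, map_sum, map_pow, regularAction_involution_pairSum hd]

omit [Group H] in
theorem _root_.RegularFunctionField.algebraMap_ne_zero_of_eval {p : MvPolynomial H K} (f : H → K)
    (h : MvPolynomial.eval f p = 1) : algebraMap _ (RegularFunctionField K H) p ≠ 0 := by
  rw [Ne, map_eq_zero_iff _ (IsFractionRing.injective (MvPolynomial H K) (RegularFunctionField K H))]
  rintro rfl
  simp at h

include hd in
-- Used with ε = 1 for p_0 and with ε = -1 for (2w - 1)p_0. Evaluating at the point with x(j 1) = 1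
-- and all other coordinates 0 gives 1 in any characteristic.
theorem sum_var_add_mul_ne_zero (ε : K) :
    ∑ g, (var K (j g) + algebraMap K _ ε * var K (j g * c)) ≠ 0 := by
  classical
  have h := algebraMap_ne_zero_of_eval (K := K) (Pi.single (j 1) 1)
    (p := ∑ g, (MvPolynomial.X (j g) + MvPolynomial.C ε * MvPolynomial.X (j g * c))) (by
      have h1 : ∀ g, j g * c ≠ j 1 := fun g => (hd.apply_ne_apply_mul 1 g).symm
      have h2 : ∀ g, j g = j 1 ↔ g = 1 := fun g => hd.injective.eq_iff
      simp only [map_sum, map_add, map_mul, MvPolynomial.eval_X, MvPolynomial.eval_C,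
        Pi.single_apply, h1, h2]
      simp)
  simpa [var, IsScalarTower.algebraMap_apply K (MvPolynomial H K) (RegularFunctionField K H)]
    using h

include hd in
theorem powerSum_zero_ne_zero : powerSum K j c 0 ≠ 0 := by
  simpa [powerSum, pairSum] using sum_var_add_mul_ne_zero hd (1 : K)

include hd in
theorem two_mul_coord_sub_one_ne_zero : 2 * coord K j c - 1 ≠ 0 := by
  have h0 := powerSum_zero_ne_zero (K := K) hd
  have h : 2 * moment K j c 0 - powerSum K j c 0 ≠ 0 := by
    convert sum_var_add_mul_ne_zero hd (-1 : K) using 1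
    simp only [moment, powerSum, pairSum, Finset.mul_sum, ← Finset.sum_sub_distrib]
    refine Finset.sum_congr rfl fun g _ => ?_
    rw [map_neg, map_one]
    ring
  intro hw
  apply h
  have : coord K j c * powerSum K j c 0 = moment K j c 0 := div_mul_cancel₀ _ h0
  linear_combination powerSum K j c 0 * hw - 2 * this

theorem regularAction_coord (a : G) : regularAction K H (j a) (coord K j c) = coord K j c := by
  rw [coord, map_div₀, regularAction_moment, regularAction_powerSum]

include hd in
theorem regularAction_involution_coord : regularAction K H c (coord K j c) = 1 - coord K j c := by
  rw [coord, map_div₀, regularAction_involution_moment hd, regularAction_involution_powerSum hd,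
    sub_div, div_self (powerSum_zero_ne_zero hd)]

include hd in
theorem coord_mul_one_sub_mem [Finite H] :
    coord K j c * (1 - coord K j c) ∈ noetherField K H := by
  rw [mem_noetherField_iff hd]
  refine ⟨fun a => ?_, ?_⟩
  · rw [map_mul, map_sub, map_one, regularAction_coord]
  · rw [map_mul, map_sub, map_one, regularAction_involution_coord hd]
    ring

include hd in
-- The involution negates both numerator and denominator.
theorem invariantMoment_mem [Finite H] (k : ℕ) : invariantMoment K j c k ∈ noetherField K H := by
  rw [mem_noetherField_iff hd]
  refine ⟨fun a => ?_, ?_⟩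
  · simp only [invariantMoment, map_div₀, map_mul, map_sub, map_one, map_ofNat,
      regularAction_coord, regularAction_moment, regularAction_powerSum]
  · simp only [invariantMoment, map_div₀, map_mul, map_sub, map_one, map_ofNat,
      regularAction_involution_coord hd, regularAction_involution_moment hd,
      regularAction_involution_powerSum hd]
    rw [← neg_div_neg_eq]
    congr 1 <;> ring

/-- The generators of `K(H)` over `K(G)`. -/
noncomputable def generator [Finite H] (K : Type u) [Field K] (hd : IsProdInvolution j c)
    (k : ℕ) : noetherField K H :=
  -- The invariant moment at k = 0 vanishes, since m_0 = w p_0; its slot is free for w(1 - w).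
  if k = 0 then ⟨_, coord_mul_one_sub_mem hd⟩ else ⟨_, invariantMoment_mem hd k⟩

/-- Solving the definition of θ_k for m_k puts the moments in `S`; interpolation at the nodes s(g)
then yields the variables. -/
theorem subfield_eq_top [Finite H] {S : Subfield (RegularFunctionField K H)}
    (hS : ∀ x : RegularFunctionField K G, embedding K hd x ∈ S)
    (hT : ∀ k < Fintype.card G, (generator K hd k : RegularFunctionField K H) ∈ S)
    (hw : coord K j c ∈ S) : S = ⊤ := by
  have hs : ∀ g, pairSum K j c g ∈ S := fun g => by
    rw [← embedding_var hd]
    exact hS _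
  have hP : ∀ k, powerSum K j c k ∈ S := fun k => sum_mem fun g _ => pow_mem (hs g) _
  have h2 : (2 * coord K j c - 1) ∈ S := sub_mem (mul_mem (ofNat_mem S 2) hw) (one_mem S)
  have hX : ∀ k < Fintype.card G, moment K j c k ∈ S := fun k hk => by
    rcases eq_or_ne k 0 with rfl | hk0
    · rw [← div_mul_cancel₀ (moment K j c 0) (powerSum_zero_ne_zero hd)]
      exact mul_mem hw (hP 0)
    · have hθ : invariantMoment K j c k ∈ S := by
        have := hT k hk
        rwa [generator, if_neg hk0] at this
      have : moment K j c k = invariantMoment K j c k * (2 * coord K j c - 1) +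
          coord K j c * powerSum K j c k := by
        rw [invariantMoment, div_mul_cancel₀ _ (two_mul_coord_sub_one_ne_zero hd), sub_add_cancel]
      rw [this]
      exact add_mem (mul_mem hθ h2) (mul_mem hw (hP k))
  have hx : ∀ g, var K (j g) ∈ S :=
    S.mem_of_power_moments_mem _ (fun g => var K (j g)) (pairSum_injective hd) hs hX
  refine RegularFunctionField.subfield_eq_top (fun k => ?_) fun h => ?_
  · rw [← (embedding K hd).commutes]
    exact hS _
  · obtain ⟨g, rfl | rfl⟩ := hd.exists_eq h
    · exact hx g
    · have : var K (j g * c) = pairSum K j c g - var K (j g) := by simp [pairSum]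
      rw [this]
      exact sub_mem (hs g) (hx g)

end Moments

/-- `K(H)` is rational over `K(G)` when `H` is the product of `G` with a group of order two. -/
theorem isRationalOver_noetherEmbedding [Finite G] [Finite H] :
    IsRationalOver (noetherEmbedding K hd).fieldRange (noetherField K H) := by
  have := Fintype.ofFinite G
  rw [isRationalOver_fieldRange]
  let _ : Algebra (noetherField K G) (noetherField K H) :=
    (noetherEmbedding K hd).toRingHom.toAlgebra
  let _ : Algebra (RegularFunctionField K G) (RegularFunctionField K H) :=
    (embedding K hd).toRingHom.toAlgebra
  have : IsScalarTower (noetherField K G) (RegularFunctionField K G) (RegularFunctionField K H) :=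
    IsScalarTower.of_algebraMap_eq fun _ => rfl
  have : IsScalarTower (noetherField K G) (noetherField K H) (RegularFunctionField K H) :=
    IsScalarTower.of_algebraMap_eq fun _ => rfl
  have : IsScalarTower K (noetherField K G) (RegularFunctionField K H) :=
    IsScalarTower.of_algebraMap_eq fun k => ((embedding K hd).commutes k).symm
  have := finiteDimensional_noetherField K (G := G)
  have := finiteDimensional_noetherField K (G := H)
  have hcard : 0 < Fintype.card G := Fintype.card_pos
  refine isRationalOver_of_degree_le (E := RegularFunctionField K G)
    (M := RegularFunctionField K H) (N := Fintype.card G) ?_ ?_ ?_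
    (fun k => generator K hd k) (coord K j c) ⟨⟨0, hcard⟩, rfl⟩ fun S hE hT hw => ?_
  · rw [finrank_noetherField, Nat.card_eq_fintype_card]
  · rw [finrank_noetherField, hd.card_eq, Nat.card_eq_fintype_card]
  · have h := trdeg_add_eq_of_field K (noetherField K G) (RegularFunctionField K H)
    rw [trdeg_noetherField, trdeg_eq, hd.card_eq, two_mul, Nat.cast_add,
      Nat.card_eq_fintype_card] at h
    exact Cardinal.eq_of_add_eq_add_left h (Cardinal.natCast_lt_aleph0)
  · exact subfield_eq_top hd hE (fun k hk => hT ⟨k, hk⟩) hw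

end IsProdInvolution

/-! ### Splitting the dihedral group -/

/-- For odd `n`, reduction modulo `n` on `ZMod (2 * n)` has an additive section. -/
theorem ZMod.exists_section_cast_two_mul {n : ℕ} (hn : Odd n) :
    ∃ a : ZMod n →+ ZMod (2 * n), ∀ i, ZMod.castHom (Dvd.intro_left 2 rfl) (ZMod n) (a i) = i := by
  obtain ⟨k, hk⟩ := hn
  have h0 : ((n * (n + 1) : ℕ) : ZMod (2 * n)) = 0 := by
    rw [ZMod.natCast_eq_zero_iff]
    exact ⟨k + 1, by rw [hk]; ring⟩
  -- Multiplication by n + 1 is a section: n + 1 is 1 modulo n, and n(n + 1) is 0 modulo 2n because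
  -- n + 1 is even.
  refine ⟨ZMod.lift n ⟨(AddMonoidHom.mulRight ((n + 1 : ℕ) : ZMod (2 * n))).comp
    (Int.castAddHom (ZMod (2 * n))), ?_⟩, fun i => ?_⟩
  · simpa using h0
  · obtain ⟨m, rfl⟩ := ZMod.intCast_surjective i
    simp

theorem ZMod.natCast_self_two_mul_ne_zero {n : ℕ} (hn : Odd n) : ((n : ℕ) : ZMod (2 * n)) ≠ 0 := by
  rw [Ne, ZMod.natCast_eq_zero_iff]
  intro h
  have := Nat.le_of_dvd hn.pos h
  have := hn.pos
  omega

/-- For odd `n`, the dihedral group `D_{2n}` is the product of `D_n` and its center. -/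
theorem DihedralGroup.exists_isProdInvolution {n : ℕ} (hn : Odd n) :
    ∃ (j : DihedralGroup n →* DihedralGroup (2 * n)) (c : DihedralGroup (2 * n)),
      IsProdInvolution j c := by
  obtain ⟨a, ha⟩ := ZMod.exists_section_cast_two_mul hn
  have hinj : Function.Injective a := Function.LeftInverse.injective ha
  have hnn : (n : ZMod (2 * n)) + n = 0 := by
    rw [← two_mul]
    exact_mod_cast ZMod.natCast_self (2 * n)
  have hneg : -(n : ZMod (2 * n)) = n := neg_eq_of_add_eq_zero_left hnn
  let j : DihedralGroup n →* DihedralGroup (2 * n) :=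
    { toFun := fun g => match g with
        | .r i => .r (a i)
        | .sr i => .sr (a i)
      map_one' := by
        change DihedralGroup.r (a 0) = DihedralGroup.r 0
        rw [map_zero]
      map_mul' := by
        rintro (x | x) (y | y) <;> simp }
  -- The half-turn is central because -n = n modulo 2n.
  refine ⟨j, .r n, ?_, ?_, ?_, ?_, ?_⟩
  · rintro (x | x) (y | y) h
    · exact congrArg _ (hinj (DihedralGroup.r.inj h))
    · cases h
    · cases h
    · exact congrArg _ (hinj (DihedralGroup.sr.inj h))
  · rintro (x | x)
    · simp [add_comm]
    · simp [sub_eq_add_neg, hneg]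
  · rw [DihedralGroup.r_mul_r, hnn, DihedralGroup.r_zero]
  · rintro (x | x) h
    · have hx : a x = n := DihedralGroup.r.inj h
      -- Reducing a(x) = n modulo n gives x = 0, whence n = 0 modulo 2n, which is absurd.
      have h0 : x = 0 := by rw [← ha x, hx]; simp
      rw [h0, map_zero] at hx
      exact ZMod.natCast_self_two_mul_ne_zero hn hx.symm
    · cases h
  · rw [DihedralGroup.nat_card, DihedralGroup.nat_card]

theorem theorem1p5 (K : Type*) [Field K] (n : ℕ) (hn : Odd n) :
    (∃ i : noetherField K (DihedralGroup n) →ₐ[K] noetherField K (DihedralGroup (2 * n)),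
      IsRationalOver i.fieldRange (noetherField K (DihedralGroup (2 * n)))) ∧
    (IsRationalOver K (noetherField K (DihedralGroup n)) →
      IsRationalOver K (noetherField K (DihedralGroup (2 * n)))) ∧
    (IsRetractRationalOver K (noetherField K (DihedralGroup n)) →
      IsRetractRationalOver K (noetherField K (DihedralGroup (2 * n)))) := by
  have : NeZero n := ⟨hn.pos.ne'⟩
  have : NeZero (2 * n) := ⟨by have := hn.pos; omega⟩
  obtain ⟨j, c, hd⟩ := DihedralGroup.exists_isProdInvolution hn
  have : Finite (DihedralGroup n) := Finite.of_fintype _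
  have : Finite (DihedralGroup (2 * n)) := Finite.of_fintype _
  have hrat := hd.isRationalOver_noetherEmbedding (K := K)
  exact ⟨⟨_, hrat⟩, IsRationalOver.of_fieldRange _ hrat, IsRetractRationalOver.of_fieldRange _ hrat⟩
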